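/- Let $k \ge 1$, let $\mu \in \mathbb{R}^k$, let $\Sigma \in \mathbb{R}^{k\times k}$ be a (possibly singular) symmetric positive semidefinite matrix, let $X=(X_1,\ldots,X_k) \sim \mathcal{N}_k(\mu,\Sigma)$ be a multivariate Gaussian random vector on a probability space, and let $\delta_i := \sqrt{\Sigma_{i,i}}$ be the standard deviation of $X_i$, $i=1,\ldots,k$. Then $\max_i |X_i|$ is integrable, and for every $s \ge 0$ $$\mathbb{P}\left(\max_i |X_i| - \mathbb{E}\max_i |X_i| \ge s\right) \le \exp\left(-\frac{s^2}{2\max_i \delta_i^2}\right).$$ In the degenerate case $\max_i \delta_i = 0$ the right-hand side is read as $0$ for $s>0$ and as $1$ for $s=0$. -/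

import Mathlib

open MeasureTheory ProbabilityTheory

/-- The maximum `max_i a i` of a finite nonempty family of real numbers. -/
noncomputable def finMax {k : ℕ} [NeZero k] (a : Fin k → ℝ) : ℝ :=
  Finset.univ.sup' Finset.univ_nonempty a

/-! ### Integrability under a Gaussian measure and the rotation identity. -/

namespace ProbabilityTheory.IsGaussian

open scoped NNReal

variable {E : Type*} [NormedAddCommGroup E] [NormedSpace ℝ E] [MeasurableSpace E] [BorelSpace E]
  [SecondCountableTopology E] [CompleteSpace E] {γ : Measure E} [IsGaussian γ]

/-! Since `max |X i|` is the maximum of the functionals `± X i`, it suffices to prove a sub-Gaussian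
bound for a finite maximum of functionals `L j` with variances at most `σ2`; the tail bound is then
Chernoff's.

The bound is first proved for smooth functions whose gradient is everywhere a sub-convex combination
of the `L j`. By Cauchy–Schwarz, a small increment of size `h` has variance at most `h ^ 2 * σ2 +
O(h ^ 3)`, so its centered exponential moment at `a` is at most `exp (σ2 * a ^ 2 / 2 * h ^ 2 + D * h
^ 3)`, with `D` uniform over the class (`exists_integral_exp_le_of_small`). Rotation invariance
writes a centered Gaussian vector as a sum of `n` independent copies scaled by `h = 1 / √n`
(`map_sqrt_smul_add`). Integrating out one copy at a time keeps the function in the class with the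
same constants (`HasMixtureDerivative.integral`), so the bounds multiply; the total error `n * D * h
^ 3 = D / √n` vanishes, leaving the sharp constant (`HasMixtureDerivative.integral_exp_le`).

The maximum is a uniform limit of log-sum-exp functions, whose gradients are softmax mixtures of the
`L j`. -/

lemma integrable_exp_mul_norm (γ : Measure E) [IsGaussian γ] (a : ℝ) :
    Integrable (fun x ↦ Real.exp (a * ‖x‖)) γ := by
  obtain ⟨c, hc, hint⟩ := IsGaussian.exists_integrable_exp_sq γ
  refine (hint.const_mul (Real.exp (a ^ 2 / (4 * c)))).mono' (by fun_prop)
    (Filter.Eventually.of_forall fun x ↦ ?_)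
  rw [Real.norm_eq_abs, Real.abs_exp, ← Real.exp_add]
  refine Real.exp_le_exp.2 ?_
  have h : a ^ 2 / (4 * c) + c * ‖x‖ ^ 2 - a * ‖x‖ = (a - 2 * c * ‖x‖) ^ 2 / (4 * c) := by
    field_simp; ring
  have : 0 ≤ (a - 2 * c * ‖x‖) ^ 2 / (4 * c) := by positivity
  linarith

lemma integrable_norm_pow (γ : Measure E) [IsGaussian γ] (n : ℕ) :
    Integrable (fun x ↦ ‖x‖ ^ n) γ := by
  have h := (IsGaussian.memLp_id γ n (by simp)).integrable_norm_pow'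
  simpa using h

lemma integrable_exp_mul_of_lipschitzWith (γ : Measure E) [IsGaussian γ] {F : E → ℝ} {A : ℝ≥0}
    (hF : LipschitzWith A F) (a : ℝ) : Integrable (fun x ↦ Real.exp (a * F x)) γ := by
  have hFm : Measurable F := hF.continuous.measurable
  refine ((integrable_exp_mul_norm γ (|a| * A)).const_mul (Real.exp (a * F 0))).mono'
    (by fun_prop) (Filter.Eventually.of_forall fun x ↦ ?_)
  rw [Real.norm_eq_abs, Real.abs_exp, ← Real.exp_add]
  refine Real.exp_le_exp.2 ?_
  have h := hF.dist_le_mul x 0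
  rw [Real.dist_eq, dist_zero_right] at h
  have h2 : a * (F x - F 0) ≤ |a| * (A * ‖x‖) :=
    (le_abs_self _).trans (by rw [abs_mul]; gcongr)
  linarith

lemma integrable_of_lipschitzWith (γ : Measure E) [IsGaussian γ] {F : E → ℝ} {A : ℝ≥0}
    (hF : LipschitzWith A F) : Integrable F γ := by
  have hFm : Measurable F := hF.continuous.measurable
  refine (((integrable_norm_pow γ 1).const_mul (A : ℝ)).add (integrable_const |F 0|)).mono'
    (by fun_prop) (Filter.Eventually.of_forall fun x ↦ ?_)
  have h := hF.dist_le_mul x 0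
  rw [Real.dist_eq, dist_zero_right] at h
  have := abs_sub_abs_le_abs_sub (F x) (F 0)
  simp only [Real.norm_eq_abs, Pi.add_apply, pow_one]
  linarith

/-- If `x` and `y` are independent with the same centered Gaussian law, then `√n • x + y` has the
law of `√(n + 1) • x`. -/
lemma map_sqrt_smul_add (hγ : γ[id] = 0) (n : ℕ) :
    (γ.prod γ).map (fun p ↦ √n • p.1 + p.2) = γ.map (fun x ↦ √(n + 1 : ℕ) • x) := by
  have hs : (0 : ℝ) < √(n + 1 : ℕ) := Real.sqrt_pos.2 (by positivity)
  have hsq : (√(n + 1 : ℕ)) ^ 2 = n + 1 := by rw [Real.sq_sqrt (by positivity)]; simp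
  have hnq : (√n : ℝ) ^ 2 = n := Real.sq_sqrt (by positivity)
  -- With this angle, `√(n + 1)` times the first coordinate of the rotated pair is `√n • x + y`.
  obtain ⟨θ, hc, hsn⟩ : ∃ θ : ℝ, Real.cos θ = √n / √(n + 1 : ℕ) ∧
      Real.sin θ = 1 / √(n + 1 : ℕ) := by
    refine ⟨Real.arcsin (1 / √(n + 1 : ℕ)), ?_, Real.sin_arcsin ?_ ?_⟩
    · rw [Real.cos_arcsin, ← Real.sqrt_div (by positivity)]
      congr 1
      rw [div_pow, hsq]; push_cast; field_simp; ring
    · exact le_trans (by norm_num) (by positivity : (0 : ℝ) ≤ 1 / √(n + 1 : ℕ))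
    · rw [div_le_one hs, Real.one_le_sqrt]; simp
  have hrot := IsGaussian.map_rotation_eq_self hγ θ
  have hfst : (γ.prod γ).map Prod.fst = γ := by simp
  conv_rhs => rw [← hfst, ← hrot]
  rw [Measure.map_map (by fun_prop) (by fun_prop), Measure.map_map (by fun_prop) (by fun_prop)]
  congr 1
  ext p
  simp only [Function.comp_apply, ContinuousLinearMap.rotation_apply, smul_add, smul_smul, hc, hsn]
  rw [mul_div_cancel₀ _ hs.ne', mul_one_div_cancel hs.ne', one_smul]

end ProbabilityTheory.IsGaussian


/-! ### Exponential moments of functions with a mixture derivative. -/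

namespace ProbabilityTheory.IsGaussian

open scoped NNReal

lemma _root_.LipschitzWith.comp_smul_add {E : Type*} [NormedAddCommGroup E] [NormedSpace ℝ E]
    {F : E → ℝ} {A : ℝ≥0} (hF : LipschitzWith A F) (h : ℝ) (x : E) :
    LipschitzWith (A * ‖h‖₊) (fun z ↦ F (h • z + x)) := by
  refine hF.comp (LipschitzWith.of_dist_le_mul fun y z ↦ ?_)
  simp [dist_eq_norm, ← smul_sub, norm_smul]

/-- The exact coefficient `1 / 2` of `y ^ 2` is what yields the sharp constant; the remainder only
has to be cubic and integrable. -/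
lemma exp_le_quadratic_add_cube (y : ℝ) :
    Real.exp y ≤ 1 + y + y ^ 2 / 2 + |y| ^ 3 * Real.exp |y| := by
  have h := Complex.norm_exp_sub_sum_le_norm_mul_exp (y : ℂ) 3
  have h2 : Complex.exp y - ∑ m ∈ Finset.range 3, (y : ℂ) ^ m / (m.factorial : ℂ)
      = ((Real.exp y - (1 + y + y ^ 2 / 2) : ℝ) : ℂ) := by
    simp [Finset.sum_range_succ, Nat.factorial]
  rw [h2, Complex.norm_real, Complex.norm_real, Real.norm_eq_abs, Real.norm_eq_abs] at h
  linarith [le_abs_self (Real.exp y - (1 + y + y ^ 2 / 2))]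

lemma abs_integral_le_of_forall_abs_le {α : Type*} [MeasurableSpace α] (ν : Measure α)
    [IsProbabilityMeasure ν] {f : α → ℝ} {C : ℝ} (hf : ∀ x, |f x| ≤ C) : |∫ x, f x ∂ν| ≤ C := by
  simpa using norm_integral_le_of_norm_le_const (μ := ν) (f := f) (Filter.Eventually.of_forall hf)

/-- Lipschitz functions whose increments are, up to a uniform quadratic error, measurable
sub-convex combinations of a finite family of linear functionals. -/
structure HasMixtureDerivative {E ι : Type*} [NormedAddCommGroup E] [NormedSpace ℝ E]
    [MeasurableSpace E] [Fintype ι] (L : ι → StrongDual ℝ E) (A : ℝ≥0) (C : ℝ) (F : E → ℝ) :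
    Prop where
  lipschitz : LipschitzWith A F
  exists_weights : ∃ p : E → ι → ℝ, (∀ j, Measurable fun x ↦ p x j) ∧ (∀ x j, 0 ≤ p x j) ∧
    (∀ x, ∑ j, p x j ≤ 1) ∧ ∀ x u, |F (x + u) - F x - ∑ j, p x j * L j u| ≤ C * ‖u‖ ^ 2

section

variable {E ι : Type*} [NormedAddCommGroup E] [NormedSpace ℝ E] [MeasurableSpace E] [Fintype ι]
  {L : ι → StrongDual ℝ E} {A : ℝ≥0} {C : ℝ} {F : E → ℝ}

/-- The second moment of a small increment of a function with a mixture derivative. -/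
lemma HasMixtureDerivative.sq_sub_le (hF : HasMixtureDerivative L A C F) {h : ℝ} (h0 : 0 ≤ h)
    (h1 : h ≤ 1) :
    ∃ q : ι → ℝ, (∀ j, 0 ≤ q j) ∧ ∑ j, q j ≤ 1 ∧ ∀ z, (F (h • z) - F 0) ^ 2 ≤
      h ^ 2 * ∑ j, q j * L j z ^ 2 + h ^ 3 * (2 * A * C * ‖z‖ ^ 3 + C ^ 2 * ‖z‖ ^ 4) := by
  obtain ⟨p, hpm, hp0, hp1, hp⟩ := hF.exists_weights
  refine ⟨p 0, hp0 0, hp1 0, fun z ↦ ?_⟩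
  have hR := hp 0 (h • z)
  have hG := hF.lipschitz.dist_le_mul (h • z) 0
  rw [Real.dist_eq, dist_zero_right, norm_smul, Real.norm_of_nonneg h0] at hG
  simp only [zero_add, map_smul, smul_eq_mul, norm_smul, Real.norm_of_nonneg h0] at hR
  have hℓ : ∑ j, p 0 j * (h * L j z) = h * ∑ j, p 0 j * L j z := by
    rw [Finset.mul_sum]; exact Finset.sum_congr rfl fun j _ ↦ by ring
  rw [hℓ] at hR
  -- Cauchy–Schwarz for weights of total mass at most one.
  have hcs : (∑ j, p 0 j * L j z) ^ 2 ≤ ∑ j, p 0 j * L j z ^ 2 := by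
    have hnn : 0 ≤ ∑ j, p 0 j * L j z ^ 2 :=
      Finset.sum_nonneg fun j _ ↦ mul_nonneg (hp0 0 j) (sq_nonneg _)
    calc (∑ j, p 0 j * L j z) ^ 2 ≤ (∑ j, p 0 j) * ∑ j, p 0 j * L j z ^ 2 :=
          Finset.sum_sq_le_sum_mul_sum_of_sq_le_mul _ (fun j _ ↦ hp0 0 j)
            (fun j _ ↦ mul_nonneg (hp0 0 j) (sq_nonneg _)) fun j _ ↦ le_of_eq (by ring)
      _ ≤ 1 * ∑ j, p 0 j * L j z ^ 2 := by gcongr; exact hp1 0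
      _ = _ := one_mul _
  set ℓ := ∑ j, p 0 j * L j z
  set G := F (h • z) - F 0
  have hCz : 0 ≤ C * ‖z‖ ^ 2 := (abs_nonneg _).trans (by simpa using hp 0 z)
  have key : G ^ 2 - (h * ℓ) ^ 2 ≤
      C * (h * ‖z‖) ^ 2 * (2 * (A * (h * ‖z‖)) + C * (h * ‖z‖) ^ 2) := by
    have : G ^ 2 - (h * ℓ) ^ 2 = (G - h * ℓ) * (2 * G - (G - h * ℓ)) := by ring
    rw [this]
    refine (le_abs_self _).trans ?_
    rw [abs_mul]
    refine mul_le_mul hR ((abs_sub _ _).trans ?_) (abs_nonneg _) ((abs_nonneg _).trans hR)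
    rw [abs_mul, abs_two]
    gcongr
  have h4 : h ^ 4 ≤ h ^ 3 := pow_le_pow_of_le_one h0 h1 (by norm_num)
  have h5 : h ^ 4 * (C ^ 2 * ‖z‖ ^ 4) ≤ h ^ 3 * (C ^ 2 * ‖z‖ ^ 4) := by gcongr
  have h6 : h ^ 2 * ℓ ^ 2 ≤ h ^ 2 * ∑ j, p 0 j * L j z ^ 2 := by gcongr
  nlinarith [key, h5, h6]

lemma HasMixtureDerivative.comp_add_right [MeasurableAdd E] (hF : HasMixtureDerivative L A C F) (x : E) :
    HasMixtureDerivative L A C (fun z ↦ F (z + x)) := by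
  obtain ⟨p, hpm, hp0, hp1, hp⟩ := hF.exists_weights
  refine ⟨?_, fun z ↦ p (z + x), fun j ↦ (hpm j).comp (measurable_id.add_const x),
    fun z ↦ hp0 _, fun z ↦ hp1 _, fun z u ↦ ?_⟩
  · simpa using hF.lipschitz.comp_smul_add 1 x
  · simpa [add_right_comm z u x] using hp (z + x) u

end

variable {E ι : Type*} [NormedAddCommGroup E] [NormedSpace ℝ E] [MeasurableSpace E] [BorelSpace E]
  [SecondCountableTopology E] [CompleteSpace E] [Fintype ι] {γ : Measure E} [IsGaussian γ]
  {L : ι → StrongDual ℝ E} {A : ℝ≥0} {C : ℝ} {F : E → ℝ}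

/-- Averaging the weights gives weights for the averaged function. That `A` and `C` do not
deteriorate lets the same `D` serve at every step of the iteration. -/
lemma HasMixtureDerivative.integral (hF : HasMixtureDerivative L A C F) (h : ℝ) :
    HasMixtureDerivative L A C (fun w ↦ ∫ z, F (h • z + w) ∂γ) := by
  have hint (w : E) : Integrable (fun z ↦ F (h • z + w)) γ :=
    integrable_of_lipschitzWith γ (hF.lipschitz.comp_smul_add h w)
  obtain ⟨p, hpm, hp0, hp1, hp⟩ := hF.exists_weights
  have hple (x : E) (j : ι) : p x j ≤ 1 :=
    (Finset.single_le_sum (fun i _ ↦ hp0 x i) (Finset.mem_univ j)).trans (hp1 x)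
  have hpint (w : E) (j : ι) : Integrable (fun z ↦ p (h • z + w) j) γ :=
    (integrable_const (1 : ℝ)).mono' ((hpm j).comp (by fun_prop)).aestronglyMeasurable
      (Filter.Eventually.of_forall fun z ↦ by
        rw [Real.norm_eq_abs, abs_of_nonneg (hp0 _ _)]; exact hple _ _)
  refine ⟨LipschitzWith.of_dist_le_mul fun x y ↦ ?_, fun w j ↦ ∫ z, p (h • z + w) j ∂γ,
    fun j ↦ ?_, fun w j ↦ integral_nonneg fun z ↦ hp0 _ _, fun w ↦ ?_, fun w u ↦ ?_⟩
  · rw [Real.dist_eq, ← integral_sub (hint x) (hint y)]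
    refine abs_integral_le_of_forall_abs_le γ fun z ↦ ?_
    simpa [Real.dist_eq] using hF.lipschitz.dist_le_mul (h • z + x) (h • z + y)
  · have : Measurable fun q : E × E ↦ p (h • q.2 + q.1) j := (hpm j).comp (by fun_prop)
    exact this.stronglyMeasurable.integral_prod_right'.measurable
  · rw [← integral_finsetSum _ fun j _ ↦ hpint w j]
    calc ∫ z, ∑ j, p (h • z + w) j ∂γ ≤ ∫ _, (1 : ℝ) ∂γ :=
          integral_mono (integrable_finsetSum _ fun j _ ↦ hpint w j) (integrable_const _)
            fun z ↦ hp1 _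
      _ = 1 := by simp
  · have hsum : ∑ j, (∫ z, p (h • z + w) j ∂γ) * L j u
        = ∫ z, ∑ j, p (h • z + w) j * L j u ∂γ := by
      rw [integral_finsetSum _ fun j _ ↦ (hpint w j).mul_const _]
      simp_rw [integral_mul_const]
    have hd : Integrable (fun z ↦ F (h • z + (w + u)) - F (h • z + w)) γ :=
      (hint _).sub (hint _)
    rw [hsum, ← integral_sub (hint _) (hint _), ← integral_sub hd
      (integrable_finsetSum _ fun j _ ↦ (hpint w j).mul_const _)]
    refine abs_integral_le_of_forall_abs_le γ fun z ↦ ?_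
    simpa [add_assoc] using hp (h • z + w) u

/-- The moment generating function of a small Gaussian increment, with an error term that is
uniform over functions with a mixture derivative. -/
lemma exists_integral_exp_le_of_small {σ2 : ℝ} (hσ : ∀ j, ∫ z, L j z ^ 2 ∂γ ≤ σ2)
    (hσ0 : 0 ≤ σ2) (A : ℝ≥0) (C a : ℝ) :
    ∃ D : ℝ, ∀ F : E → ℝ, HasMixtureDerivative L A C F → ∀ h : ℝ, 0 ≤ h → h ≤ 1 →
      ∫ z, Real.exp (a * F (h • z)) ∂γ ≤
        Real.exp (σ2 * a ^ 2 / 2 * h ^ 2 + D * h ^ 3 + a * ∫ z, F (h • z) ∂γ) := by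
  let Q : E → ℝ := fun z ↦ 2 * A * C * ‖z‖ ^ 3 + C ^ 2 * ‖z‖ ^ 4
  -- `h * W` dominates the centered increment multiplied by `a`, so `W` controls the cubic remainder
  -- for all `F` and all `h ≤ 1` at once.
  let W : E → ℝ := fun z ↦ |a| * (A * (‖z‖ + ∫ x, ‖x‖ ∂γ))
  have hQ : Integrable Q γ :=
    ((integrable_norm_pow γ 3).const_mul _).add ((integrable_norm_pow γ 4).const_mul _)
  have hM : 0 ≤ ∫ x, ‖x‖ ∂γ := integral_nonneg fun _ ↦ norm_nonneg _
  have hW0 (z : E) : 0 ≤ W z := by positivity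
  have hWm : Measurable W := by fun_prop
  have hW : Integrable (fun z ↦ W z ^ 3 * Real.exp (W z)) γ := by
    refine ((integrable_exp_mul_norm γ (2 * (|a| * A))).const_mul
      (6 * Real.exp (2 * (|a| * (A * ∫ x, ‖x‖ ∂γ))))).mono' (by fun_prop)
      (Filter.Eventually.of_forall fun z ↦ ?_)
    have h3 : W z ^ 3 ≤ 6 * Real.exp (W z) := by
      have := Real.pow_div_factorial_le_exp (W z) (hW0 z) 3
      norm_num [Nat.factorial] at this
      linarith
    rw [Real.norm_of_nonneg (by have := hW0 z; positivity), mul_assoc, ← Real.exp_add]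
    calc W z ^ 3 * Real.exp (W z) ≤ 6 * Real.exp (W z) * Real.exp (W z) := by gcongr
      _ = 6 * Real.exp (W z + W z) := by rw [Real.exp_add]; ring
      _ = _ := by congr 2; simp only [W]; ring
  refine ⟨a ^ 2 / 2 * ∫ z, Q z ∂γ + ∫ z, W z ^ 3 * Real.exp (W z) ∂γ,
    fun F hF h h0 h1 ↦ ?_⟩
  have hlip : LipschitzWith (A * ‖h‖₊) (fun z ↦ F (h • z)) := by
    simpa using hF.lipschitz.comp_smul_add h 0
  have hFint := integrable_of_lipschitzWith γ hlip
  have hFm : Measurable fun z ↦ F (h • z) := hlip.continuous.measurable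
  set G : E → ℝ := fun z ↦ F (h • z) - F 0 with hGdef
  have hGm : Measurable G := hFm.sub_const _
  have hGint : Integrable G γ := hFint.sub (integrable_const _)
  have hGb (z : E) : |G z| ≤ A * (h * ‖z‖) := by
    have hG := hF.lipschitz.dist_le_mul (h • z) 0
    rwa [Real.dist_eq, dist_zero_right, norm_smul, Real.norm_of_nonneg h0] at hG
  set m := ∫ z, G z ∂γ with hm
  have hmF : ∫ z, F (h • z) ∂γ = m + F 0 := by
    rw [hm, integral_sub hFint (integrable_const _)]; simp
  have hnormint : Integrable (fun z : E ↦ ‖z‖) γ := by simpa using integrable_norm_pow γ 1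
  have hmb : |m| ≤ A * (h * ∫ z, ‖z‖ ∂γ) := by
    refine (abs_integral_le_integral_abs).trans ?_
    rw [← integral_const_mul, ← integral_const_mul]
    exact integral_mono hGint.abs ((hnormint.const_mul _).const_mul _) hGb
  have hYb (z : E) : |a * (G z - m)| ≤ h * W z := by
    rw [abs_mul]
    calc |a| * |G z - m| ≤ |a| * (A * (h * ‖z‖) + A * (h * ∫ z, ‖z‖ ∂γ)) := by
          gcongr; exact (abs_sub _ _).trans (add_le_add (hGb z) hmb)
      _ = h * W z := by simp only [W]; ring
  obtain ⟨q, hq0, hq1, hq⟩ := hF.sq_sub_le h0 h1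
  have hLint (j : ι) : Integrable (fun z ↦ L j z ^ 2) γ :=
    (IsGaussian.memLp_dual γ (L j) 2 (by simp)).integrable_sq
  have hqint : Integrable (fun z ↦ ∑ j, q j * L j z ^ 2) γ :=
    integrable_finsetSum _ fun j _ ↦ (hLint j).const_mul _
  have hG2int : Integrable (fun z ↦ G z ^ 2) γ := by
    refine ((hqint.const_mul (h ^ 2)).add (hQ.const_mul (h ^ 3))).mono' (by fun_prop)
      (Filter.Eventually.of_forall fun z ↦ ?_)
    rw [Real.norm_of_nonneg (sq_nonneg _)]
    exact hq z
  have hG2 : ∫ z, G z ^ 2 ∂γ ≤ h ^ 2 * σ2 + h ^ 3 * ∫ z, Q z ∂γ := by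
    calc ∫ z, G z ^ 2 ∂γ ≤ ∫ z, (h ^ 2 * ∑ j, q j * L j z ^ 2 + h ^ 3 * Q z) ∂γ :=
          integral_mono hG2int ((hqint.const_mul _).add (hQ.const_mul _)) hq
      _ = h ^ 2 * ∑ j, q j * ∫ z, L j z ^ 2 ∂γ + h ^ 3 * ∫ z, Q z ∂γ := by
          rw [integral_add (hqint.const_mul _) (hQ.const_mul _), integral_const_mul,
            integral_const_mul, integral_finsetSum _ fun j _ ↦ (hLint j).const_mul _]
          simp_rw [integral_const_mul]
      _ ≤ h ^ 2 * ∑ j, q j * σ2 + h ^ 3 * ∫ z, Q z ∂γ := by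
          gcongr with j; exacts [hq0 j, hσ j]
      _ ≤ h ^ 2 * σ2 + h ^ 3 * ∫ z, Q z ∂γ := by
          rw [← Finset.sum_mul]
          gcongr
          exact mul_le_of_le_one_left hσ0 hq1
  have hG2L : MemLp G 2 γ := (memLp_two_iff_integrable_sq hGm.aestronglyMeasurable).2 hG2int
  have hY2int : Integrable (fun z ↦ (G z - m) ^ 2) γ := (hG2L.sub (memLp_const m)).integrable_sq
  -- Centering kills the linear term and does not increase the second moment.
  have hY2 : ∫ z, (G z - m) ^ 2 ∂γ ≤ h ^ 2 * σ2 + h ^ 3 * ∫ z, Q z ∂γ := by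
    refine le_trans ?_ hG2
    rw [hm, ← variance_eq_integral hGm.aemeasurable]
    exact variance_le_expectation_sq hGm.aestronglyMeasurable
  have hY0 : ∫ z, (G z - m) ∂γ = 0 := by
    rw [integral_sub hGint (integrable_const _)]; simp [hm]
  have hYint : Integrable (fun z ↦ G z - m) γ := hGint.sub (integrable_const _)
  have hpt (z : E) : Real.exp (a * (G z - m)) ≤ 1 + a * (G z - m) + a ^ 2 / 2 * (G z - m) ^ 2
      + h ^ 3 * (W z ^ 3 * Real.exp (W z)) := by
    have h1' : h * W z ≤ W z := mul_le_of_le_one_left (hW0 z) h1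
    have h2 : |a * (G z - m)| ^ 3 * Real.exp |a * (G z - m)| ≤ (h * W z) ^ 3 * Real.exp (W z) := by
      gcongr
      exacts [hYb z, (hYb z).trans h1']
    have h3 := exp_le_quadratic_add_cube (a * (G z - m))
    rw [mul_pow] at h2
    linarith [mul_pow a (G z - m) 2]
  have hexp : ∫ z, Real.exp (a * (G z - m)) ∂γ ≤ 1 + a ^ 2 / 2 * (h ^ 2 * σ2 + h ^ 3 * ∫ z, Q z ∂γ)
      + h ^ 3 * ∫ z, W z ^ 3 * Real.exp (W z) ∂γ := by
    have i1 : Integrable (fun z ↦ 1 + a * (G z - m)) γ :=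
      (integrable_const (1 : ℝ)).add (hYint.const_mul a)
    have i2 : Integrable (fun z ↦ 1 + a * (G z - m) + a ^ 2 / 2 * (G z - m) ^ 2) γ :=
      i1.add (hY2int.const_mul _)
    have i3 : Integrable (fun z ↦ 1 + a * (G z - m) + a ^ 2 / 2 * (G z - m) ^ 2
        + h ^ 3 * (W z ^ 3 * Real.exp (W z))) γ := i2.add (hW.const_mul (h ^ 3))
    refine (integral_mono_of_nonneg (Filter.Eventually.of_forall fun z ↦ (Real.exp_pos _).le)
      i3 (Filter.Eventually.of_forall hpt)).trans ?_
    rw [integral_add i2 (hW.const_mul _), integral_add i1 (hY2int.const_mul _),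
      integral_add (integrable_const _) (hYint.const_mul a), integral_const_mul,
      integral_const_mul, integral_const_mul, hY0]
    simp only [integral_const, probReal_univ, smul_eq_mul, mul_one, mul_zero, add_zero]
    gcongr
  have hfac (z : E) : Real.exp (a * F (h • z))
      = Real.exp (a * (m + F 0)) * Real.exp (a * (G z - m)) := by
    rw [← Real.exp_add]; congr 1; simp only [hGdef]; ring
  rw [hmF]
  simp_rw [hfac]
  rw [integral_const_mul, mul_comm, Real.exp_add _ (a * (m + F 0))]
  gcongr
  refine hexp.trans (le_trans (le_of_eq ?_) (Real.add_one_le_exp _))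
  ring

/-- **Sharp Gaussian concentration** of the moment generating function for smooth functions. -/
lemma HasMixtureDerivative.integral_exp_le (hγ : γ[id] = 0) {σ2 : ℝ}
    (hσ : ∀ j, ∫ z, L j z ^ 2 ∂γ ≤ σ2) (hσ0 : 0 ≤ σ2) (hF : HasMixtureDerivative L A C F)
    (a : ℝ) :
    ∫ z, Real.exp (a * F z) ∂γ ≤ Real.exp (σ2 * a ^ 2 / 2 + a * ∫ z, F z ∂γ) := by
  obtain ⟨D, hD⟩ := exists_integral_exp_le_of_small hσ hσ0 A C a
  -- `F` is quantified inside the induction because the hypothesis is applied to the average of `F`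
  -- over the newest copy.
  have iter (h : ℝ) (h0 : 0 ≤ h) (h1 : h ≤ 1) (n : ℕ) : ∀ F, HasMixtureDerivative L A C F →
      ∫ z, Real.exp (a * F (h • √n • z)) ∂γ ≤ Real.exp
        (n * (σ2 * a ^ 2 / 2 * h ^ 2 + D * h ^ 3) + a * ∫ z, F (h • √n • z) ∂γ) := by
    induction n with
    | zero => intro F _; simp
    | succ n ih =>
      intro F hF
      have hlip : LipschitzWith (A * ‖h‖₊) (fun z ↦ F (h • z)) := by
        simpa using hF.lipschitz.comp_smul_add h 0
      have hcomp (f : E → ℝ) (hf : Continuous f)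
          (hfi : Integrable (fun z ↦ f (√(n + 1 : ℕ) • z)) γ) :
          Integrable (fun p : E × E ↦ f (√n • p.1 + p.2)) (γ.prod γ) ∧
          ∫ z, f (√(n + 1 : ℕ) • z) ∂γ = ∫ x, ∫ y, f (√n • x + y) ∂γ ∂γ := by
        have hi : Integrable (fun p : E × E ↦ f (√n • p.1 + p.2)) (γ.prod γ) := by
          have := (integrable_map_measure (μ := γ.prod γ) (f := fun p : E × E ↦ √n • p.1 + p.2)
            hf.aestronglyMeasurable (by fun_prop)).1
          refine this ?_
          rw [map_sqrt_smul_add hγ]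
          exact (integrable_map_measure hf.aestronglyMeasurable (by fun_prop)).2 hfi
        refine ⟨hi, ?_⟩
        rw [← integral_prod _ hi, ← integral_map (f := f) (by fun_prop) hf.aestronglyMeasurable,
          ← map_sqrt_smul_add hγ, integral_map (by fun_prop) hf.aestronglyMeasurable]
      have hlip' : LipschitzWith (A * ‖h * √(n + 1 : ℕ)‖₊) (fun z ↦ F (h • √(n + 1 : ℕ) • z)) := by
        simpa [smul_smul] using hF.lipschitz.comp_smul_add (h * √(n + 1 : ℕ)) 0
      obtain ⟨-, e1⟩ := hcomp (fun z ↦ F (h • z)) hlip.continuous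
        (integrable_of_lipschitzWith γ hlip')
      obtain ⟨i2, e2⟩ := hcomp (fun z ↦ Real.exp (a * F (h • z)))
        (Real.continuous_exp.comp (hlip.continuous.const_mul a)) (integrable_exp_mul_of_lipschitzWith γ hlip' a)
      have hF' := hF.integral (γ := γ) h
      have hlipF' : LipschitzWith (A * ‖h * √n‖₊)
          (fun x ↦ ∫ y, F (h • y + h • √n • x) ∂γ) := by
        simpa [smul_smul] using hF'.lipschitz.comp_smul_add (h * √n) 0
      have hcomm (x y : E) : h • (√n • x + y) = h • y + h • √n • x := by
        rw [smul_add, add_comm]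
      rw [e1, e2]
      simp_rw [hcomm] at i2 ⊢
      set c := σ2 * a ^ 2 / 2 * h ^ 2 + D * h ^ 3
      calc ∫ x, ∫ y, Real.exp (a * F (h • y + h • √n • x)) ∂γ ∂γ
          ≤ ∫ x, Real.exp c * Real.exp (a * ∫ y, F (h • y + h • √n • x) ∂γ) ∂γ := by
            refine integral_mono i2.integral_prod_left
              ((integrable_exp_mul_of_lipschitzWith γ hlipF' a).const_mul _) fun x ↦ ?_
            simp only
            rw [← Real.exp_add]
            exact hD _ (hF.comp_add_right _) h h0 h1
        _ ≤ Real.exp c * Real.exp (n * c + a * ∫ x, ∫ y, F (h • y + h • √n • x) ∂γ ∂γ) := by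
            rw [integral_const_mul]
            gcongr
            exact ih _ hF'
        _ = _ := by rw [← Real.exp_add]; congr 1; push_cast; ring
  have hN (n : ℕ) : ∫ z, Real.exp (a * F z) ∂γ ≤
      Real.exp (σ2 * a ^ 2 / 2 + D * (√(n + 1 : ℕ))⁻¹ + a * ∫ z, F z ∂γ) := by
    have hs : (0 : ℝ) < √(n + 1 : ℕ) := Real.sqrt_pos.2 (by positivity)
    have hsq : ((n + 1 : ℕ) : ℝ) = √(n + 1 : ℕ) ^ 2 := (Real.sq_sqrt (by positivity)).symm
    -- With `n + 1` steps of this size, the squared sizes sum to one and the cubes to `1 / √(n +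
    -- 1)`.
    have h := iter (√(n + 1 : ℕ))⁻¹ (by positivity)
      (inv_le_one_of_one_le₀ (Real.one_le_sqrt.2 (by simp))) (n + 1) F hF
    simp_rw [inv_smul_smul₀ hs.ne'] at h
    refine h.trans (le_of_eq ?_)
    congr 2
    generalize √(n + 1 : ℕ) = s at hs hsq
    rw [hsq]
    field_simp
  have hlim : Filter.Tendsto (fun n : ℕ ↦ (√(n + 1 : ℕ))⁻¹) Filter.atTop (nhds 0) :=
    tendsto_inv_atTop_zero.comp (Real.tendsto_sqrt_atTop.comp
      (tendsto_natCast_atTop_atTop.comp (Filter.tendsto_add_atTop_nat 1)))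
  have := ((hlim.const_mul D).const_add (σ2 * a ^ 2 / 2)).add_const (a * ∫ z, F z ∂γ)
  rw [mul_zero, add_zero] at this
  exact ge_of_tendsto' ((Real.continuous_exp.tendsto _).comp this) hN

end ProbabilityTheory.IsGaussian


/-! ### Smoothing the maximum by log-sum-exp, and the Borell–TIS bound. -/

namespace ProbabilityTheory.IsGaussian

open scoped NNReal

section LogSumExp

variable {ι : Type*} [Fintype ι]

lemma abs_log_sum_mul_exp_le {p v : ι → ℝ} {m : ℝ} (hp0 : ∀ j, 0 ≤ p j) (hp1 : ∑ j, p j = 1)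
    (hv : ∀ j, |v j| ≤ m) : |Real.log (∑ j, p j * Real.exp (v j))| ≤ m := by
  have hlo : Real.exp (-m) ≤ ∑ j, p j * Real.exp (v j) := by
    rw [← one_mul (Real.exp (-m)), ← hp1, Finset.sum_mul]
    gcongr with j
    exacts [hp0 j, (abs_le.1 (hv j)).1]
  have hup : ∑ j, p j * Real.exp (v j) ≤ Real.exp m := by
    rw [← one_mul (Real.exp m), ← hp1, Finset.sum_mul]
    gcongr with j
    exacts [hp0 j, (abs_le.1 (hv j)).2]
  have hpos := (Real.exp_pos _).trans_le hlo
  exact abs_le.2 ⟨(Real.le_log_iff_exp_le hpos).2 hlo, (Real.log_le_iff_le_exp hpos).2 hup⟩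

lemma abs_log_sum_mul_exp_sub_sum_le {p v : ι → ℝ} {m : ℝ} (hp0 : ∀ j, 0 ≤ p j)
    (hp1 : ∑ j, p j = 1) (hv : ∀ j, |v j| ≤ m) :
    |Real.log (∑ j, p j * Real.exp (v j)) - ∑ j, p j * v j| ≤ 2 * m ^ 2 := by
  have hm : 0 ≤ m := by
    obtain ⟨j⟩ : Nonempty ι := by
      by_contra h
      rw [not_nonempty_iff] at h
      simp at hp1
    exact (abs_nonneg _).trans (hv j)
  -- For small `m`, Jensen bounds the difference below and a second-order expansion bounds it above;
  -- for `m ≥ 1` both terms are at most `m ≤ m ^ 2`.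
  rcases le_total m 1 with h1 | h1
  · have hlo : Real.exp (∑ j, p j * v j) ≤ ∑ j, p j * Real.exp (v j) := by
      have := convexOn_exp.map_sum_le (t := Finset.univ) (w := p) (p := v) (fun j _ ↦ hp0 j) hp1
        (fun _ _ ↦ Set.mem_univ _)
      simpa using this
    have hpos := (Real.exp_pos _).trans_le hlo
    have hup : ∑ j, p j * Real.exp (v j) ≤ 1 + ∑ j, p j * v j + m ^ 2 := by
      calc ∑ j, p j * Real.exp (v j) ≤ ∑ j, (p j + p j * v j + p j * m ^ 2) := by
            refine Finset.sum_le_sum fun j _ ↦ ?_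
            have h2 := Real.abs_exp_sub_one_sub_id_le ((hv j).trans h1)
            have h3 : v j ^ 2 ≤ m ^ 2 := sq_le_sq' (abs_le.1 (hv j)).1 (abs_le.1 (hv j)).2
            have h4 : Real.exp (v j) ≤ 1 + v j + m ^ 2 := by linarith [(abs_le.1 h2).2]
            linarith [mul_le_mul_of_nonneg_left h4 (hp0 j)]
        _ = _ := by
            rw [Finset.sum_add_distrib, Finset.sum_add_distrib, ← Finset.sum_mul, hp1, one_mul]
    rw [abs_of_nonneg (sub_nonneg.2 ((Real.le_log_iff_exp_le hpos).2 hlo))]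
    linarith [Real.log_le_sub_one_of_pos hpos, sq_nonneg m]
  · have h2 := abs_log_sum_mul_exp_le hp0 hp1 hv
    have h3 : |∑ j, p j * v j| ≤ m := by
      refine (Finset.abs_sum_le_sum_abs _ _).trans ?_
      rw [← one_mul m, ← hp1, Finset.sum_mul]
      refine Finset.sum_le_sum fun j _ ↦ ?_
      rw [abs_mul, abs_of_nonneg (hp0 j)]
      exact mul_le_mul_of_nonneg_left (hv j) (hp0 j)
    have h4 : m ≤ m ^ 2 := by nlinarith
    linarith [abs_sub (Real.log (∑ j, p j * Real.exp (v j))) (∑ j, p j * v j)]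

variable {E : Type*} [NormedAddCommGroup E] [NormedSpace ℝ E]

/-- The smooth approximation `β⁻¹ log ∑ⱼ exp (β Lⱼ x)` of `maxⱼ Lⱼ x`. -/
noncomputable def logSumExp (L : ι → StrongDual ℝ E) (β : ℝ) (x : E) : ℝ :=
  β⁻¹ * Real.log (∑ j, Real.exp (β * L j x))

variable [Nonempty ι]

lemma sup'_le_logSumExp (L : ι → StrongDual ℝ E) {β : ℝ} (hβ : 0 < β) (x : E) :
    Finset.univ.sup' Finset.univ_nonempty (fun j ↦ L j x) ≤ logSumExp L β x := by
  refine Finset.sup'_le _ _ fun j _ ↦ ?_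
  rw [logSumExp, le_inv_mul_iff₀ hβ, Real.le_log_iff_exp_le (by positivity)]
  exact Finset.single_le_sum (f := fun j ↦ Real.exp (β * L j x))
    (fun _ _ ↦ (Real.exp_pos _).le) (Finset.mem_univ j)

lemma logSumExp_le_sup'_add (L : ι → StrongDual ℝ E) {β : ℝ} (hβ : 0 < β) (x : E) :
    logSumExp L β x ≤ Finset.univ.sup' Finset.univ_nonempty (fun j ↦ L j x)
      + β⁻¹ * Real.log (Fintype.card ι) := by
  set M := Finset.univ.sup' Finset.univ_nonempty (fun j ↦ L j x)
  have h : ∑ j, Real.exp (β * L j x) ≤ Fintype.card ι * Real.exp (β * M) := by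
    rw [← nsmul_eq_mul]
    refine Finset.sum_le_card_nsmul _ _ _ fun j hj ↦ ?_
    gcongr
    exact Finset.le_sup' (fun j ↦ L j x) hj
  have hlog := Real.log_le_log (by positivity) h
  rw [Real.log_mul (by simp) (Real.exp_pos _).ne', Real.log_exp] at hlog
  rw [logSumExp, inv_mul_le_iff₀ hβ, mul_add, mul_inv_cancel_left₀ hβ.ne']
  linarith

lemma lipschitzWith_sup' {L : ι → StrongDual ℝ E} {A : ℝ≥0} (hL : ∀ j, ‖L j‖ ≤ A) :
    LipschitzWith A (fun x ↦ Finset.univ.sup' Finset.univ_nonempty (fun j ↦ L j x)) := by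
  refine LipschitzWith.of_le_add_mul A fun x y ↦ Finset.sup'_le _ _ fun j hj ↦ ?_
  have h1 : L j (x - y) ≤ A * dist x y := by
    rw [dist_eq_norm]
    exact (le_abs_self _).trans ((L j).le_of_opNorm_le (hL j) _)
  have h2 := Finset.le_sup' (fun j ↦ L j y) hj
  rw [map_sub] at h1
  linarith

/-- The weights are the softmax of `β * L j x`, and an increment is `β⁻¹` times the log of a softmax
average. The error `2 * m ^ 2` at `m = β * A * ‖u‖`, divided by `β`, gives the constant. -/
lemma hasMixtureDerivative_logSumExp [MeasurableSpace E] [BorelSpace E]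
    {L : ι → StrongDual ℝ E} {A : ℝ≥0} (hL : ∀ j, ‖L j‖ ≤ A) {β : ℝ} (hβ : 0 < β) :
    HasMixtureDerivative L A (2 * β * A ^ 2) (logSumExp L β) := by
  let p : E → ι → ℝ := fun x j ↦ Real.exp (β * L j x) / ∑ i, Real.exp (β * L i x)
  have hp0 (x : E) (j : ι) : 0 ≤ p x j := by positivity
  have hp1 (x : E) : ∑ j, p x j = 1 := by
    simp only [p]
    rw [← Finset.sum_div]
    exact div_self (by positivity)
  have hinc (x u : E) : logSumExp L β (x + u) - logSumExp L β x
      = β⁻¹ * Real.log (∑ j, p x j * Real.exp (β * L j u)) := by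
    rw [logSumExp, logSumExp, ← mul_sub, ← Real.log_div (by positivity) (by positivity),
      Finset.sum_div]
    congr 2
    refine Finset.sum_congr rfl fun j _ ↦ ?_
    simp only [p]
    rw [map_add, mul_add, Real.exp_add]
    ring
  have hv (u : E) (j : ι) : |β * L j u| ≤ β * (A * ‖u‖) := by
    rw [abs_mul, abs_of_pos hβ]
    gcongr
    exact (L j).le_of_opNorm_le (hL j) u
  refine ⟨LipschitzWith.of_dist_le_mul fun y x ↦ ?_, p, fun j ↦ ?_, hp0, fun x ↦ (hp1 x).le,
    fun x u ↦ ?_⟩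
  · have h := hinc x (y - x)
    rw [add_sub_cancel] at h
    rw [Real.dist_eq, h, abs_mul, abs_of_pos (inv_pos.2 hβ), inv_mul_le_iff₀ hβ, dist_eq_norm]
    exact abs_log_sum_mul_exp_le (hp0 x) (hp1 x) (hv _)
  · simp only [p]
    fun_prop
  · have h := abs_log_sum_mul_exp_sub_sum_le (hp0 x) (hp1 x) (hv u)
    have hs : ∑ j, p x j * L j u = β⁻¹ * ∑ j, p x j * (β * L j u) := by
      rw [Finset.mul_sum]
      refine Finset.sum_congr rfl fun j _ ↦ ?_
      field_simp
    rw [hinc, hs, ← mul_sub, abs_mul, abs_of_pos (inv_pos.2 hβ), inv_mul_le_iff₀ hβ]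
    refine h.trans (le_of_eq ?_)
    ring

end LogSumExp

variable {E ι : Type*} [NormedAddCommGroup E] [NormedSpace ℝ E] [MeasurableSpace E] [BorelSpace E]
  [SecondCountableTopology E] [CompleteSpace E] [Fintype ι] [Nonempty ι]

lemma integral_exp_mul_sup'_le {γ : Measure E} [IsGaussian γ] (hγ : γ[id] = 0)
    {L : ι → StrongDual ℝ E} {σ2 : ℝ} (hσ : ∀ j, ∫ z, L j z ^ 2 ∂γ ≤ σ2) (hσ0 : 0 ≤ σ2) (m : E)
    (a : ℝ) :
    ∫ z, Real.exp (a * Finset.univ.sup' Finset.univ_nonempty (fun j ↦ L j (z + m))) ∂γ ≤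
      Real.exp (σ2 * a ^ 2 / 2
        + a * ∫ z, Finset.univ.sup' Finset.univ_nonempty (fun j ↦ L j (z + m)) ∂γ) := by
  obtain ⟨A, hA⟩ : ∃ A : ℝ≥0, ∀ j, ‖L j‖ ≤ A := ⟨∑ j, ‖L j‖₊, fun j ↦ by
    exact_mod_cast Finset.single_le_sum (f := fun j ↦ ‖L j‖₊) (fun _ _ ↦ zero_le)
      (Finset.mem_univ j)⟩
  set M : E → ℝ := fun z ↦ Finset.univ.sup' Finset.univ_nonempty (fun j ↦ L j (z + m)) with hM
  have hMlip : LipschitzWith (A * ‖(1 : ℝ)‖₊) M := by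
    simpa only [one_smul] using (lipschitzWith_sup' hA).comp_smul_add 1 m
  have hMint := integrable_of_lipschitzWith γ hMlip
  set K := Real.log (Fintype.card ι)
  -- The smoothing error `β⁻¹ * K` enters twice, in the exponential moment and in the mean.
  have hβ (β : ℝ) (hβ : 0 < β) : ∫ z, Real.exp (a * M z) ∂γ ≤
      Real.exp (σ2 * a ^ 2 / 2 + a * ∫ z, M z ∂γ + 2 * |a| * K * β⁻¹) := by
    have hF := (hasMixtureDerivative_logSumExp hA hβ).comp_add_right m
    have hFint := integrable_of_lipschitzWith γ hF.lipschitz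
    have hb (z : E) : |logSumExp L β (z + m) - M z| ≤ β⁻¹ * K := by
      rw [abs_of_nonneg (sub_nonneg.2 (sup'_le_logSumExp L hβ (z + m)))]
      linarith [logSumExp_le_sup'_add L hβ (z + m)]
    have hbi : |∫ z, logSumExp L β (z + m) ∂γ - ∫ z, M z ∂γ| ≤ β⁻¹ * K := by
      rw [← integral_sub hFint hMint]
      exact abs_integral_le_of_forall_abs_le γ hb
    have hmul {t : ℝ} (ht : |t| ≤ β⁻¹ * K) : |a * t| ≤ |a| * (β⁻¹ * K) := by
      rw [abs_mul]; gcongr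
    calc ∫ z, Real.exp (a * M z) ∂γ
        ≤ ∫ z, Real.exp (|a| * (β⁻¹ * K)) * Real.exp (a * logSumExp L β (z + m)) ∂γ := by
          refine integral_mono (integrable_exp_mul_of_lipschitzWith γ hMlip a)
            ((integrable_exp_mul_of_lipschitzWith γ hF.lipschitz a).const_mul _) fun z ↦ ?_
          simp only
          rw [← Real.exp_add]
          gcongr
          linarith [(abs_le.1 (hmul (hb z))).1]
      _ ≤ Real.exp (|a| * (β⁻¹ * K)) *
          Real.exp (σ2 * a ^ 2 / 2 + a * ∫ z, logSumExp L β (z + m) ∂γ) := by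
          rw [integral_const_mul]
          gcongr
          exact hF.integral_exp_le hγ hσ hσ0 a
      _ ≤ _ := by
          rw [← Real.exp_add]
          refine Real.exp_le_exp.2 ?_
          linarith [(abs_le.1 (hmul hbi)).2]
  have hlim := (tendsto_inv_atTop_zero (𝕜 := ℝ)).const_mul (2 * |a| * K)
    |>.const_add (σ2 * a ^ 2 / 2 + a * ∫ z, M z ∂γ)
  rw [mul_zero, add_zero] at hlim
  exact ge_of_tendsto ((Real.continuous_exp.tendsto _).comp hlim)
    ((Filter.eventually_gt_atTop 0).mono hβ)

lemma integrable_sup' (γ : Measure E) [IsGaussian γ] (L : ι → StrongDual ℝ E) :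
    Integrable (fun x ↦ Finset.univ.sup' Finset.univ_nonempty (fun j ↦ L j x)) γ := by
  refine integrable_of_lipschitzWith γ (lipschitzWith_sup' (A := ∑ j, ‖L j‖₊) fun j ↦ ?_)
  exact_mod_cast Finset.single_le_sum (f := fun j ↦ ‖L j‖₊) (fun _ _ ↦ zero_le)
    (Finset.mem_univ j)

/-- **Borell–TIS inequality** for finitely many jointly Gaussian variables: the centered maximum is
sub-Gaussian with parameter the maximal variance. -/
theorem hasSubgaussianMGF_sup' (γ : Measure E) [IsGaussian γ] {L : ι → StrongDual ℝ E} {c : ℝ≥0}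
    (hc : ∀ j, Var[L j; γ] ≤ c) :
    HasSubgaussianMGF (fun x ↦ Finset.univ.sup' Finset.univ_nonempty (fun j ↦ L j x)
      - ∫ y, Finset.univ.sup' Finset.univ_nonempty (fun j ↦ L j y) ∂γ) c γ := by
  have hlip := lipschitzWith_sup' (L := L) (A := ∑ j, ‖L j‖₊) fun j ↦ by
    exact_mod_cast Finset.single_le_sum (f := fun j ↦ ‖L j‖₊) (fun _ _ ↦ zero_le)
      (Finset.mem_univ j)
  set M : E → ℝ := fun x ↦ Finset.univ.sup' Finset.univ_nonempty (fun j ↦ L j x) with hM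
  have hexp (t x : ℝ) (I : ℝ) : Real.exp (t * (x - I)) = Real.exp (-(t * I)) * Real.exp (t * x) := by
    rw [← Real.exp_add]; ring_nf
  refine ⟨fun t ↦ ?_, fun t ↦ ?_⟩
  · simp_rw [hexp]
    exact (integrable_exp_mul_of_lipschitzWith γ hlip t).const_mul _
  -- The rotation argument needs a centered measure, so the mean is moved into the argument of the
  -- maximum.
  · set m := ∫ x, x ∂γ with hm
    set γ₀ := γ.map (fun x ↦ x - m) with hγ₀
    have hchange (f : E → ℝ) (hf : Continuous f) : ∫ z, f (z + m) ∂γ₀ = ∫ x, f x ∂γ := by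
      rw [hγ₀, integral_map (by fun_prop) (by fun_prop)]; simp
    have hzero : γ₀[id] = 0 := by
      rw [hγ₀, integral_map (by fun_prop) (by fun_prop)]
      simp only [id]
      rw [integral_sub IsGaussian.integrable_fun_id (integrable_const _)]
      simp [hm]
    have hvar (j : ι) : ∫ z, L j z ^ 2 ∂γ₀ ≤ c := by
      refine le_of_eq_of_le ?_ (hc j)
      rw [hγ₀, integral_map (by fun_prop) (by fun_prop),
        variance_eq_integral (L j).continuous.aemeasurable, IsGaussian.integral_dual]
      simp [hm]
    have h := integral_exp_mul_sup'_le hzero hvar c.2 m t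
    have hMc : Continuous M := hlip.continuous
    have e1 := hchange M hMc
    have e2 := hchange (fun x ↦ Real.exp (t * M x)) (by fun_prop)
    simp only [hM] at e1 e2
    rw [e1, e2] at h
    rw [mgf]
    simp_rw [hexp]
    rw [integral_const_mul]
    refine (mul_le_mul_of_nonneg_left h (Real.exp_pos _).le).trans (le_of_eq ?_)
    rw [← Real.exp_add]
    congr 1
    ring

end ProbabilityTheory.IsGaussian

/-! ### The maximum of absolute values of a Gaussian vector. -/

/-- Both signs of every coordinate, as continuous linear functionals. -/
noncomputable def signedProj {k : ℕ} (q : Fin k × Bool) : StrongDual ℝ (EuclideanSpace ℝ (Fin k)) :=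
  if q.2 then EuclideanSpace.proj q.1 else -EuclideanSpace.proj q.1

lemma finMax_abs_eq_sup' {k : ℕ} [NeZero k] (x : EuclideanSpace ℝ (Fin k)) :
    finMax (fun i ↦ |x i|) = Finset.univ.sup' Finset.univ_nonempty (fun q ↦ signedProj q x) := by
  refine le_antisymm (Finset.sup'_le _ _ fun i _ ↦ ?_) (Finset.sup'_le _ _ fun q _ ↦ ?_)
  · refine max_le ?_ ?_
    · exact le_of_eq_of_le (by simp [signedProj])
        (Finset.le_sup' (fun q ↦ signedProj q x) (Finset.mem_univ (i, true)))
    · exact le_of_eq_of_le (by simp [signedProj])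
        (Finset.le_sup' (fun q ↦ signedProj q x) (Finset.mem_univ (i, false)))
  · refine le_trans ?_ (Finset.le_sup' (fun i ↦ |x i|) (Finset.mem_univ q.1))
    rcases q with ⟨i, _ | _⟩
    · simpa [signedProj] using neg_le_abs (x i)
    · simpa [signedProj] using le_abs_self (x i)

lemma variance_signedProj_multivariateGaussian {k : ℕ} (μ : EuclideanSpace ℝ (Fin k))
    {S : Matrix (Fin k) (Fin k) ℝ} (hS : S.PosSemidef) (q : Fin k × Bool) :
    Var[signedProj q; multivariateGaussian μ S] = S q.1 q.1 := by
  rw [← variance_eval_multivariateGaussian (μ := μ) hS q.1]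
  rcases q with ⟨i, _ | _⟩
  · exact variance_neg
  · rfl

theorem mainTheorem4 {Ω : Type*} [MeasurableSpace Ω] (P : Measure Ω) [IsProbabilityMeasure P]
    (k : ℕ) [NeZero k]
    (μ : EuclideanSpace ℝ (Fin k)) (S : Matrix (Fin k) (Fin k) ℝ) (hS : S.PosSemidef)
    (X : Ω → EuclideanSpace ℝ (Fin k)) (hX : HasLaw X (multivariateGaussian μ S) P)
    (δ : Fin k → ℝ) (hδ : ∀ i, δ i = √(S i i)) :
    Integrable (fun ω => finMax fun i => |X ω i|) P ∧
    ∀ s : ℝ, 0 ≤ s →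
      P.real {ω | s ≤ (finMax fun i => |X ω i|) - ∫ ω', (finMax fun i => |X ω' i|) ∂P}
          ≤ Real.exp (-(s ^ 2 / (2 * finMax (fun i => δ i ^ 2)))) ∧
      (finMax (fun i => δ i ^ 2) = 0 → 0 < s →
        P.real {ω | s ≤ (finMax fun i => |X ω i|) - ∫ ω', (finMax fun i => |X ω' i|) ∂P} = 0) := by
  have hδS (i : Fin k) : δ i ^ 2 = S i i := by
    rw [hδ, Real.sq_sqrt hS.diag_nonneg]
  have hle (i : Fin k) : S i i ≤ finMax (fun i => δ i ^ 2) := by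
    rw [← hδS]; exact Finset.le_sup' (fun i => δ i ^ 2) (Finset.mem_univ i)
  have hc0 : 0 ≤ finMax (fun i => δ i ^ 2) := hS.diag_nonneg.trans (hle 0)
  generalize finMax (fun i => δ i ^ 2) = c at hle hc0
  lift c to NNReal using hc0
  simp_rw [finMax_abs_eq_sup']
  have hint := IsGaussian.integrable_sup' (multivariateGaussian μ S) (signedProj (k := k))
  have hsub := IsGaussian.hasSubgaussianMGF_sup' (multivariateGaussian μ S) (c := c)
    (L := signedProj (k := k))
    fun q ↦ (variance_signedProj_multivariateGaussian μ hS q).trans_le (hle q.1)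
  rw [← hX.integral_comp hint.aestronglyMeasurable, ← hX.map_eq] at hsub
  rw [← hX.map_eq] at hint
  replace hsub := HasSubgaussianMGF.of_map hX.aemeasurable hsub
  refine ⟨hint.comp_aemeasurable hX.aemeasurable, fun s hs ↦ ⟨?_, fun hc hs0 ↦ ?_⟩⟩
  · rw [← neg_div]
    exact hsub.measure_ge_le hs
  -- Here division by zero makes the exponential bound equal to `1`, so the degenerate case is
  -- separate: a sub-Gaussian variable with parameter zero vanishes almost everywhere.
  · rw [NNReal.coe_eq_zero.1 hc] at hsub
    have h0 := HasSubgaussianMGF.ae_eq_zero_of_hasSubgaussianMGF_zero hsub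
    refine (measureReal_eq_zero_iff).2 (measure_mono_null (fun ω hω ↦ ?_) h0)
    simp only [Set.mem_ofPred_eq] at hω
    intro h
    have h' : _ = (0 : ℝ) := h
    simp only [Function.comp_apply] at h'
    linarith
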